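/- Let $\|\cdot\|$ be an arbitrary norm on $\mathbb{R}^m$ with dual norm $\|z\|_*=\sup_{\|\xi\|\le 1} z^\top\xi$, let $\langle a,b\rangle=a^\top b$, and let $\Xi=\{\xi\in\mathbb{R}^m: C\xi\le d\}$ for a real matrix $C$ and vector $d$ (boundedness of $\Xi$ is not required). Let $\hat\xi_1,\dots,\hat\xi_N\in\Xi$ with $N\ge 1$, let $\hat P_N=\frac1N\sum_{i=1}^N\delta_{\hat\xi_i}$, and let $\varepsilon\ge 0$. Let $\mathcal M(\Xi)$ be the set of probability distributions $P$ supported on $\Xi$ with $\mathbb{E}^P[\|\xi\|]<\infty$, let $$d_W(P_1,P_2)=\inf_{\Pi}\int\|\xi_1-\xi_2\|\,\Pi(d\xi_1,d\xi_2),$$ where $\Pi$ ranges over all joint distributions with marginals $P_1$ and $P_2$, and let $\mathbb{B}_\varepsilon(\hat P_N)=\{P\in\mathcal M(\Xi): d_W(\hat P_N,P)\le\varepsilon\}$. For a loss function $\ell:\mathbb{R}^m\to[-\infty,\infty]$, its worst-case expectation is $\sup_{P\in\mathbb{B}_\varepsilon(\hat P_N)}\mathbb{E}^P[\ell(\xi)]$,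 where $\mathbb{E}^P[\ell]=\mathbb{E}^P[\max\{\ell,0\}]+\mathbb{E}^P[\min\{\ell,0\}]$ with the convention $\infty-\infty=\infty$. Vector inequalities are meant componentwise, and all matrices and vectors are real and of compatible dimensions. (i) Let $\ell(\xi)=\inf_y\{\langle y,Q\xi\rangle: Wy\ge h\}$ and suppose that $\{y: Wy\ge h\}$ is nonempty and compact. Then the worst-case expectation of $\ell$ equals the optimal value of $$\begin{array}{cll}\inf\limits_{\lambda,s_i,\gamma_i,y_i} & \lambda\varepsilon+\frac1N\sum_{i=1}^N s_i\\ \text{s.t.} & \langle y_i,Q\hat\xi_i\rangle+\langle\gamma_i,d-C\hat\xi_i\rangle\le s_i & \forall i\le N\\ & Wy_i\ge h & \forall i\le N\\ & \|Q^\top y_i-C^\top\gamma_i\|_*\le\lambda & \forall i\le N\\ & \gamma_i\ge 0 & \forall i\le N.\end{array}$$ (ii) Let $\ell(\xi)=\inf_y\{\langle q,y\rangle: Wy\ge H\xi+h\}$ and suppose that the dual feasible set $\{\theta\ge 0: W^\top\theta=q\}$ is nonempty and compact with vertices (extreme points) $v_1,\dots,v_K$. Then the worst-case expectation of $\ell$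 equals the optimal value of $$\begin{array}{cll}\inf\limits_{\lambda,s_i,\gamma_{ik}} & \lambda\varepsilon+\frac1N\sum_{i=1}^N s_i\\ \text{s.t.} & \langle v_k,h\rangle+\langle H^\top v_k,\hat\xi_i\rangle+\langle\gamma_{ik},d-C\hat\xi_i\rangle\le s_i & \forall i\le N,\ k\le K\\ & \|C^\top\gamma_{ik}-H^\top v_k\|_*\le\lambda & \forall i\le N,\ k\le K\\ & \gamma_{ik}\ge 0 & \forall i\le N,\ k\le K.\end{array}$$ -/

import Mathlib

open MeasureTheory Matrix
open scoped ENNReal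

noncomputable section

namespace WassersteinDRO

/-- The dual `‖z‖_* = sup {⟨z, ξ⟩ : ‖ξ‖ ≤ 1}` of the norm `p` on `ℝ^m`. -/
def dualNorm {m : ℕ} (p : Seminorm ℝ (Fin m → ℝ)) (z : Fin m → ℝ) : ℝ :=
  sSup {r : ℝ | ∃ ξ : Fin m → ℝ, p ξ ≤ 1 ∧ r = z ⬝ᵥ ξ}

/-- The polyhedron `{ξ : C ξ ≤ d}`. -/
def polyhedron {m l : ℕ} (C : Matrix (Fin l) (Fin m) ℝ) (d : Fin l → ℝ) : Set (Fin m → ℝ) :=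
  {ξ | C *ᵥ ξ ≤ d}

/-- The probability distributions supported on `S` for which the norm has finite expectation. -/
def distributions {m : ℕ} (p : Seminorm ℝ (Fin m → ℝ)) (S : Set (Fin m → ℝ)) :
    Set (Measure (Fin m → ℝ)) :=
  {Q | IsProbabilityMeasure Q ∧ Q Sᶜ = 0 ∧ ∫⁻ ξ, ENNReal.ofReal (p ξ) ∂Q < ∞}

/-- The (type-1) Wasserstein distance with transportation cost `p (ξ₁ - ξ₂)`: the infimum of the
transportation cost over all joint distributions with the given marginals. -/
def wasserstein {m : ℕ} (p : Seminorm ℝ (Fin m → ℝ)) (Q₁ Q₂ : Measure (Fin m → ℝ)) : ℝ≥0∞ :=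
  ⨅ (P : Measure ((Fin m → ℝ) × (Fin m → ℝ)))
    (_ : P.map Prod.fst = Q₁ ∧ P.map Prod.snd = Q₂),
    ∫⁻ x, ENNReal.ofReal (p (x.1 - x.2)) ∂P

/-- The empirical distribution `(1/N) ∑ δ_{ξ̂ᵢ}`. -/
def empirical {m N : ℕ} (xi : Fin N → Fin m → ℝ) : Measure (Fin m → ℝ) :=
  (N : ℝ≥0∞)⁻¹ • ∑ i, Measure.dirac (xi i)

/-- The Wasserstein ball of radius `ε` around `P` in the set of distributions on `S`. -/
def wassersteinBall {m : ℕ} (p : Seminorm ℝ (Fin m → ℝ)) (S : Set (Fin m → ℝ))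
    (P : Measure (Fin m → ℝ)) (ε : ℝ) : Set (Measure (Fin m → ℝ)) :=
  {Q | Q ∈ distributions p S ∧ wasserstein p P Q ≤ ENNReal.ofReal ε}

open Classical in
/-- The expectation `E[max(f,0)] + E[min(f,0)]` of an extended-real function, with the convention
`∞ - ∞ = ∞` (in `EReal`, `⊤ - ⊤ = ⊥`, hence the case distinction). -/
def expectation {m : ℕ} (Q : Measure (Fin m → ℝ)) (f : (Fin m → ℝ) → EReal) : EReal :=
  if ∫⁻ ξ, (f ξ).toENNReal ∂Q = ∞ then ⊤
  else ((∫⁻ ξ, (f ξ).toENNReal ∂Q : ℝ≥0∞) : EReal) - ((∫⁻ ξ, (-f ξ).toENNReal ∂Q : ℝ≥0∞) : EReal)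

/-- The worst-case expectation of the loss `f` over the Wasserstein ball of radius `ε` around the
empirical distribution of the sample `xi`. -/
def worstCaseExpectation {m N : ℕ} (p : Seminorm ℝ (Fin m → ℝ)) (S : Set (Fin m → ℝ))
    (xi : Fin N → Fin m → ℝ) (ε : ℝ) (f : (Fin m → ℝ) → EReal) : EReal :=
  ⨆ Q ∈ wassersteinBall p S (empirical xi) ε, expectation Q f

/-- The recourse cost `inf_y {⟨y, Q ξ⟩ : W y ≥ h}` with objective uncertainty. -/
def recourseObjective {m n r : ℕ} (Q : Matrix (Fin n) (Fin m) ℝ) (W : Matrix (Fin r) (Fin n) ℝ)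
    (h : Fin r → ℝ) (ξ : Fin m → ℝ) : EReal :=
  ⨅ (y : Fin n → ℝ) (_ : h ≤ W *ᵥ y), ((y ⬝ᵥ (Q *ᵥ ξ) : ℝ) : EReal)

/-- The recourse cost `inf_y {⟨q, y⟩ : W y ≥ H ξ + h}` with right-hand side uncertainty. -/
def recourseRhs {m n r : ℕ} (q : Fin n → ℝ) (W : Matrix (Fin r) (Fin n) ℝ)
    (H : Matrix (Fin r) (Fin m) ℝ) (h : Fin r → ℝ) (ξ : Fin m → ℝ) : EReal :=
  ⨅ (y : Fin n → ℝ) (_ : H *ᵥ ξ + h ≤ W *ᵥ y), ((q ⬝ᵥ y : ℝ) : EReal)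

/-- The dual feasible set `{θ ≥ 0 : Wᵀ θ = q}`. -/
def dualFeasible {n r : ℕ} (q : Fin n → ℝ) (W : Matrix (Fin r) (Fin n) ℝ) : Set (Fin r → ℝ) :=
  {θ | 0 ≤ θ ∧ Wᵀ *ᵥ θ = q}

/-- The optimal value of the finite program for objective uncertainty, with variables
`lam`, `s i`, `γ i`, `y i`. -/
def objectiveProgram {m l N n r : ℕ} (p : Seminorm ℝ (Fin m → ℝ))
    (C : Matrix (Fin l) (Fin m) ℝ) (d : Fin l → ℝ) (xi : Fin N → Fin m → ℝ) (ε : ℝ)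
    (Q : Matrix (Fin n) (Fin m) ℝ) (W : Matrix (Fin r) (Fin n) ℝ) (h : Fin r → ℝ) : EReal :=
  ⨅ (lam : ℝ) (s : Fin N → ℝ) (γ : Fin N → Fin l → ℝ) (y : Fin N → Fin n → ℝ)
    (_ : ∀ i, y i ⬝ᵥ (Q *ᵥ xi i) + γ i ⬝ᵥ (d - C *ᵥ xi i) ≤ s i ∧
      h ≤ W *ᵥ y i ∧
      dualNorm p (Qᵀ *ᵥ y i - Cᵀ *ᵥ γ i) ≤ lam ∧
      0 ≤ γ i),
    ((lam * ε + 1 / (N : ℝ) * ∑ i, s i : ℝ) : EReal)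

/-- The optimal value of the finite program for right-hand side uncertainty, with variables
`lam`, `s i`, `γ i k`; the vectors `v k` are the vertices of the dual feasible set. -/
def rhsProgram {m l N r K : ℕ} (p : Seminorm ℝ (Fin m → ℝ))
    (C : Matrix (Fin l) (Fin m) ℝ) (d : Fin l → ℝ) (xi : Fin N → Fin m → ℝ) (ε : ℝ)
    (H : Matrix (Fin r) (Fin m) ℝ) (h : Fin r → ℝ) (v : Fin K → Fin r → ℝ) : EReal :=
  ⨅ (lam : ℝ) (s : Fin N → ℝ) (γ : Fin N → Fin K → Fin l → ℝ)
    (_ : ∀ i k, v k ⬝ᵥ h + (Hᵀ *ᵥ v k) ⬝ᵥ xi i + γ i k ⬝ᵥ (d - C *ᵥ xi i) ≤ s i ∧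
      dualNorm p (Cᵀ *ᵥ γ i k - Hᵀ *ᵥ v k) ≤ lam ∧
      0 ≤ γ i k),
    ((lam * ε + 1 / (N : ℝ) * ∑ i, s i : ℝ) : EReal)

end WassersteinDRO

end

/-!
Write the loss `ℓ` as a real function that is Lipschitz for the given norm. A dual feasible point of
the worst-case expectation problem is a slope `t ≥ 0` together with values `s i` such that each cone
`s i + t * ‖ξ - ξ̂ i‖` majorizes `ℓ` on `Ξ`.

Weak duality: the infimum `g` of these cones satisfies `g (ξ̂ i) ≤ s i` and, by the triangle
inequality, `ℓ ξ ≤ g x + t * ‖ξ - x‖` for all `ξ ∈ Ξ` and all `x`. Integrating this over a transport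
plan gives `E[ℓ] ≤ t ε + (1/N) ∑ s i`. Strong duality: the pairs (transport cost, expected loss) of
the plans form a convex set, and a Lagrange multiplier for the cost budget exists by a minimax
argument. The multipliers to be considered are bounded by the Lipschitz constant of `ℓ`, hence they
range over a compact interval and the radius `ε = 0` needs no separate treatment.

The cone constraint becomes finite-dimensional by the minimax theorem once more: the minimum over
the compact recourse set is exchanged with the quantifier over `ξ ∈ Ξ`, and `t * ‖ξ - ξ̂ i‖` is a
maximum of linear functions over the compact ball of radius `t` of the dual norm. What remains is an
affine inequality on the polyhedron `Ξ`, which Farkas' lemma turns into the existence of the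
multipliers `γ ≥ 0`. For right-hand side uncertainty, linear programming duality writes `ℓ` as the
maximum of finitely many affine functions, one for each vertex.
-/

namespace WassersteinDRO

section LinearProgramming

theorem transpose_mulVec_dotProduct {𝕜 ι κ : Type*} [CommSemiring 𝕜] [Fintype ι] [Fintype κ]
    (A : Matrix ι κ 𝕜) (γ : ι → 𝕜) (x : κ → 𝕜) :
    (Aᵀ *ᵥ γ) ⬝ᵥ x = γ ⬝ᵥ (A *ᵥ x) := by
  rw [mulVec_transpose, dotProduct_mulVec]

variable {𝕜 ι κ : Type*} [Field 𝕜] [LinearOrder 𝕜] [IsStrictOrderedRing 𝕜]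

theorem mem_hull_of_forall_nonpos {V : Type*} [AddCommGroup V] [Module 𝕜 V] (s : Finset ι)
    (a : ι → Module.Dual 𝕜 V) (b : Module.Dual 𝕜 V)
    (hb : ∀ x, (∀ j ∈ s, a j x ≤ 0) → b x ≤ 0) : b ∈ PointedCone.hull 𝕜 (a '' s) := by
  classical
  induction s using Finset.induction_on generalizing a b with
  | empty =>
    have hb0 : b = 0 := LinearMap.ext fun x =>
      le_antisymm (hb x (by simp)) (by simpa using hb (-x) (by simp))
    exact hb0 ▸ zero_mem _
  | insert k s _ ih =>
    rw [Finset.coe_insert, Set.image_insert_eq]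
    by_cases hs : ∀ x, (∀ j ∈ s, a j x ≤ 0) → b x ≤ 0
    · exact Submodule.span_mono (Set.subset_insert _ _) (ih a b hs)
    push Not at hs
    obtain ⟨z, haz, hbz⟩ := hs
    have hkz : 0 < a k z := by
      by_contra! hkz
      exact hbz.not_ge (hb z (Finset.forall_mem_insert _ _ _ |>.2 ⟨hkz, haz⟩))
    obtain ⟨w, hkw, haw, hbw⟩ : ∃ w, a k w = 1 ∧ (∀ j ∈ s, a j w ≤ 0) ∧ 0 ≤ b w :=
      ⟨(a k z)⁻¹ • z, by simp [hkz.ne'],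
        fun j hj => by
          simpa using mul_nonpos_of_nonneg_of_nonpos (inv_nonneg.2 hkz.le) (haz j hj),
        by simpa using mul_nonneg (inv_nonneg.2 hkz.le) hbz.le⟩
    -- Projecting along `w` onto the kernel of `a k` removes the `k`-th constraint.
    have hproj : b - b w • a k ∈ PointedCone.hull 𝕜 ((fun j => a j - a j w • a k) '' s) := by
      refine ih _ _ fun x hx => ?_
      have := hb (x - a k x • w) (Finset.forall_mem_insert _ _ _ |>.2
        ⟨by simp [hkw], fun j hj => by simpa [mul_comm] using hx j hj⟩)
      simpa [mul_comm] using this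
    have hle : PointedCone.hull 𝕜 ((fun j => a j - a j w • a k) '' s)
        ≤ PointedCone.hull 𝕜 (insert (a k) (a '' s)) := by
      refine Submodule.span_le.2 ?_
      rintro _ ⟨j, hj, rfl⟩
      have := add_mem (Submodule.subset_span (Set.mem_insert_of_mem (a k)
        (Set.mem_image_of_mem a hj)))
        (PointedCone.smul_mem (PointedCone.hull 𝕜 (insert (a k) (a '' s)))
          (neg_nonneg.2 (haw j hj)) (Submodule.subset_span (Set.mem_insert _ _)))
      simpa [sub_eq_add_neg] using this
    simpa using add_mem (hle hproj)
      (PointedCone.smul_mem _ hbw (Submodule.subset_span (Set.mem_insert (a k) _)))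

variable [Fintype κ]

theorem dotProduct_nonpos_of_recession {A : Matrix ι κ 𝕜} {b : ι → 𝕜} {c : κ → 𝕜} {δ : 𝕜}
    {x₀ : κ → 𝕜} (hx₀ : A *ᵥ x₀ ≤ b) (hδ : ∀ x, A *ᵥ x ≤ b → c ⬝ᵥ x ≤ δ) {u : κ → 𝕜}
    (hu : A *ᵥ u ≤ 0) : c ⬝ᵥ u ≤ 0 := by
  by_contra! hcu
  have hx₀δ := hδ x₀ hx₀
  have hτ : 0 ≤ (δ - c ⬝ᵥ x₀ + 1) / (c ⬝ᵥ u) := by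
    have : 0 ≤ δ - c ⬝ᵥ x₀ + 1 := by linarith
    positivity
  have := hδ (x₀ + ((δ - c ⬝ᵥ x₀ + 1) / (c ⬝ᵥ u)) • u) (by
    rw [mulVec_add, mulVec_smul]
    exact (add_le_of_nonpos_right (smul_nonpos_of_nonneg_of_nonpos hτ hu)).trans hx₀)
  rw [dotProduct_add, dotProduct_smul, smul_eq_mul, div_mul_cancel₀ _ hcu.ne'] at this
  linarith

variable [Fintype ι]

theorem farkas {A : Matrix ι κ 𝕜} {c : κ → 𝕜} (hc : ∀ x, A *ᵥ x ≤ 0 → c ⬝ᵥ x ≤ 0) :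
    ∃ γ, 0 ≤ γ ∧ Aᵀ *ᵥ γ = c := by
  classical
  have hmem := mem_hull_of_forall_nonpos Finset.univ (fun j => dotProductEquiv 𝕜 κ (A j))
    (dotProductEquiv 𝕜 κ c) fun x hx => hc x fun j => hx j (Finset.mem_univ j)
  rw [Finset.coe_univ, Set.image_univ] at hmem
  obtain ⟨γ, hγ⟩ := (Submodule.mem_span_range_iff_exists_fun _).1 hmem
  refine ⟨fun j => γ j, fun j => (γ j).2, dotProduct_eq _ _ fun x => ?_⟩
  rw [transpose_mulVec_dotProduct, ← dotProductEquiv_apply_apply 𝕜 κ c, ← hγ, LinearMap.sum_apply]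
  rfl

theorem affine_farkas {A : Matrix ι κ 𝕜} {b : ι → 𝕜} {c : κ → 𝕜} {δ : 𝕜}
    (hne : ∃ x, A *ᵥ x ≤ b) (hδ : ∀ x, A *ᵥ x ≤ b → c ⬝ᵥ x ≤ δ) :
    ∃ γ, 0 ≤ γ ∧ Aᵀ *ᵥ γ = c ∧ γ ⬝ᵥ b ≤ δ := by
  obtain ⟨x₀, hx₀⟩ := hne
  -- Homogenize: an extra variable `τ ≥ 0` scales the right-hand sides `b` and `δ`.
  obtain ⟨γ, hγ, hγc⟩ := farkas (A := fromBlocks A (replicateCol Unit (-b)) 0 (-1))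
    (c := Sum.elim c fun _ => -δ) fun z hz => by
      obtain ⟨x, τ, rfl⟩ : ∃ x τ, z = Sum.elim x fun _ => τ := ⟨z ∘ .inl, z (.inr ()), by
        ext (_ | _) <;> rfl⟩
      have hτ : 0 ≤ τ := by
        simpa [fromBlocks_mulVec, neg_mulVec] using hz (.inr ())
      have hA : A *ᵥ x ≤ τ • b := fun j => by
        simpa [fromBlocks_mulVec, mulVec, dotProduct, mul_comm] using hz (.inl j)
      suffices c ⬝ᵥ x ≤ τ * δ by simpa [mul_comm] using this
      rcases hτ.eq_or_lt with rfl | hτ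
      · simpa using dotProduct_nonpos_of_recession hx₀ hδ (by simpa using hA)
      · have := hδ (τ⁻¹ • x) (by rwa [mulVec_smul, inv_smul_le_iff_of_pos hτ])
        rwa [dotProduct_smul, smul_eq_mul, inv_mul_le_iff₀ hτ] at this
  rw [fromBlocks_transpose, fromBlocks_mulVec] at hγc
  refine ⟨γ ∘ .inl, fun j => hγ _, ?_, ?_⟩
  · simpa using congrArg (· ∘ Sum.inl) hγc
  · have hlast : -(γ ∘ .inl ⬝ᵥ b) - γ (.inr ()) = -δ := by
      simpa [mulVec, dotProduct, mul_comm, sub_eq_add_neg] using congrFun hγc (.inr ())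
    have hslack : 0 ≤ γ (.inr ()) := hγ _
    linarith

theorem exists_le_mulVec_and_dotProduct_le {W : Matrix ι κ 𝕜} {g : ι → 𝕜} {q : κ → 𝕜} {δ : 𝕜}
    (hne : ∃ θ, 0 ≤ θ ∧ Wᵀ *ᵥ θ = q) (hδ : ∀ θ, 0 ≤ θ → Wᵀ *ᵥ θ = q → g ⬝ᵥ θ ≤ δ) :
    ∃ y, g ≤ W *ᵥ y ∧ q ⬝ᵥ y ≤ δ := by
  classical
  -- Encode `θ ≥ 0` and `Wᵀ θ = q` as the system `-θ ≤ 0`, `Wᵀ θ ≤ q`, `-Wᵀ θ ≤ -q`.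
  have hsystem : ∀ θ : ι → 𝕜, fromRows (-1 : Matrix ι ι 𝕜) (fromRows Wᵀ (-Wᵀ)) *ᵥ θ
      ≤ Sum.elim (0 : ι → 𝕜) (Sum.elim q (-q)) ↔ 0 ≤ θ ∧ Wᵀ *ᵥ θ = q := fun θ => by
    simp only [fromRows_mulVec, Sum.elim_le_elim_iff, neg_mulVec, one_mulVec, neg_le_neg_iff,
      Left.neg_nonpos_iff, le_antisymm_iff]
  simp only [← hsystem] at hne
  obtain ⟨γ, hγ, hγg, hγδ⟩ := affine_farkas hne fun θ hθ => by
    obtain ⟨hθ₀, hθq⟩ := (hsystem θ).1 hθ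
    exact hδ θ hθ₀ hθq
  obtain ⟨ρ, u, v, rfl⟩ : ∃ ρ u v, γ = Sum.elim ρ (Sum.elim u v) :=
    ⟨γ ∘ .inl, γ ∘ .inr ∘ .inl, γ ∘ .inr ∘ .inr, by ext (_ | _ | _) <;> rfl⟩
  refine ⟨u - v, ?_, ?_⟩
  · have hρ : 0 ≤ ρ := fun j => hγ (.inl j)
    have hg : -ρ + (W *ᵥ u - W *ᵥ v) = g := by
      simpa [transpose_fromRows, fromCols_mulVec, neg_mulVec, sub_eq_add_neg] using hγg
    rw [mulVec_sub, ← hg]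
    exact add_le_of_nonpos_left (neg_nonpos.2 hρ)
  · rw [dotProduct_sub, dotProduct_comm q u, dotProduct_comm q v]
    simpa [sub_eq_add_neg] using hγδ

end LinearProgramming

section Minimax

variable {E F β : Type*} [AddCommGroup E] [Module ℝ E] [TopologicalSpace E]
  [IsTopologicalAddGroup E] [ContinuousSMul ℝ E] [AddCommGroup F] [Module ℝ F] [TopologicalSpace F]
  [IsTopologicalAddGroup F] [ContinuousSMul ℝ F] [LinearOrder β] [DenselyOrdered β]

theorem exists_forall_le_of_forall_exists_le {X : Set E} {Y : Set F} {f : E → F → β}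
    (hXc : IsCompact X) (hX : Convex ℝ X) (hXne : X.Nonempty) (hY : Convex ℝ Y)
    (hfX : ∀ y ∈ Y, LowerSemicontinuousOn (fun x => f x y) X)
    (hfX' : ∀ y ∈ Y, QuasiconvexOn ℝ X fun x => f x y)
    (hfY : ∀ x ∈ X, UpperSemicontinuousOn (f x) Y) (hfY' : ∀ x ∈ X, QuasiconcaveOn ℝ Y (f x))
    {s : β} (h : ∀ y ∈ Y, ∃ x ∈ X, f x y ≤ s) : ∃ x ∈ X, ∀ y ∈ Y, f x y ≤ s := by
  by_contra! hcon
  obtain ⟨u, hu, huY, hus⟩ :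
      ∃ u : Set F, u.Finite ∧ u ⊆ Y ∧ ∀ x ∈ X, ∃ y ∈ u, s < f x y := by
    refine hXc.induction_on
      (p := fun A => ∃ u : Set F, u.Finite ∧ u ⊆ Y ∧ ∀ x ∈ A, ∃ y ∈ u, s < f x y) ?_ ?_ ?_ ?_
    · exact ⟨∅, Set.finite_empty, Set.empty_subset _, by simp⟩
    · rintro A B hAB ⟨u, hu, huY, hus⟩
      exact ⟨u, hu, huY, fun x hx => hus x (hAB hx)⟩
    · rintro A B ⟨u, hu, huY, hus⟩ ⟨v, hv, hvY, hvs⟩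
      refine ⟨u ∪ v, hu.union hv, Set.union_subset huY hvY, ?_⟩
      rintro x (hx | hx)
      · obtain ⟨y, hy, hlt⟩ := hus x hx
        exact ⟨y, .inl hy, hlt⟩
      · obtain ⟨y, hy, hlt⟩ := hvs x hx
        exact ⟨y, .inr hy, hlt⟩
    · intro x hx
      obtain ⟨y, hy, hlt⟩ := hcon x hx
      exact ⟨_, hfX y hy x hx s hlt, {y}, Set.finite_singleton y, Set.singleton_subset_iff.2 hy,
        fun z hz => ⟨y, rfl, hz⟩⟩
  obtain ⟨y, hy, hlt⟩ := Sion.exists_lt_iInf_of_lt_iInf_of_finite hXne hXc hfX hfX' hY hfY hfY' hX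
    hu huY hus
  obtain ⟨x, hx, hle⟩ := h y hy
  exact (hlt x hx).not_ge hle

end Minimax

section Seminorm

/-- The function `f` is Lipschitz with constant `L` for the distance `p (x - y)` of a seminorm. -/
def IsLipschitzFor {E : Type*} [AddCommGroup E] [Module ℝ E] (p : Seminorm ℝ E) (L : ℝ)
    (f : E → ℝ) : Prop :=
  ∀ x y, f x - f y ≤ L * p (x - y)

section AddCommGroup

variable {E ι : Type*} [AddCommGroup E] [Module ℝ E] {p : Seminorm ℝ E} {L : ℝ} {f : E → ℝ}
  {g : ι → E → ℝ} {K : Set ι}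

theorem IsLipschitzFor.of_isLeast (hg : ∀ i ∈ K, IsLipschitzFor p L (g i))
    (hf : ∀ x, IsLeast ((g · x) '' K) (f x)) : IsLipschitzFor p L f := by
  intro x y
  obtain ⟨i, hi, hfy⟩ := (hf y).1
  have hfx : f x ≤ g i x := (hf x).2 ⟨i, hi, rfl⟩
  linarith [hg i hi x y]

theorem IsLipschitzFor.of_isGreatest (hg : ∀ i ∈ K, IsLipschitzFor p L (g i))
    (hf : ∀ x, IsGreatest ((g · x) '' K) (f x)) : IsLipschitzFor p L f := by
  intro x y
  obtain ⟨i, hi, hfx⟩ := (hf x).1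
  have hfy : g i y ≤ f y := (hf y).2 ⟨i, hi, rfl⟩
  linarith [hg i hi x y]

theorem IsLipschitzFor.abs_apply_le (hf : IsLipschitzFor p L f) (x : E) :
    |f x| ≤ |f 0| + L * p x := by
  have h₁ := hf x 0
  have h₂ := hf 0 x
  rw [sub_zero] at h₁
  rw [zero_sub, map_neg_eq_map] at h₂
  exact abs_le.2 ⟨by linarith [neg_abs_le (f 0)], by linarith [le_abs_self (f 0)]⟩

theorem exists_norm_map_le_mul_seminorm [FiniteDimensional ℝ E] {F : Type*}
    [NormedAddCommGroup F] [NormedSpace ℝ F] (hp : ∀ x, p x = 0 → x = 0) (φ : E →ₗ[ℝ] F) :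
    ∃ c, 0 ≤ c ∧ ∀ x, ‖φ x‖ ≤ c * p x := by
  let : NormedAddCommGroup E := AddGroupNorm.toNormedAddCommGroup
    { p.toAddGroupSeminorm with eq_zero_of_map_eq_zero' := hp }
  let : NormedSpace ℝ E := ⟨fun r x => (map_smul_eq_mul p r x).le⟩
  let ψ : E →L[ℝ] F := ⟨φ, φ.continuous_of_finiteDimensional⟩
  exact ⟨‖ψ‖, norm_nonneg ψ, ψ.le_opNorm⟩

end AddCommGroup

section Continuous

variable {E : Type*} [NormedAddCommGroup E] [NormedSpace ℝ E] [FiniteDimensional ℝ E] {L : ℝ}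
  {f : E → ℝ}

theorem continuous_seminorm (p : Seminorm ℝ E) : Continuous p :=
  continuousOn_univ.1 (p.convexOn.continuousOn isOpen_univ)

theorem IsLipschitzFor.continuous {p : Seminorm ℝ E} (hf : IsLipschitzFor p L f) :
    Continuous f := by
  refine continuous_iff_continuousAt.2 fun x => tendsto_iff_norm_sub_tendsto_zero.2 ?_
  have hlim : Filter.Tendsto (fun y => L * p (y - x)) (nhds x) (nhds 0) := by
    simpa using ((((continuous_seminorm p).comp (continuous_sub_right x)).const_mul L).tendsto x)
  refine squeeze_zero (fun _ => norm_nonneg _) (fun y => abs_le.2 ⟨?_, hf y x⟩) hlim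
  rw [map_sub_rev]
  linarith [hf x y]

theorem IsLipschitzFor.integrable_comp [MeasurableSpace E] [BorelSpace E] {Ω : Type*}
    [MeasurableSpace Ω] {μ : Measure Ω} [IsFiniteMeasure μ] {X : Ω → E} {p : Seminorm ℝ E}
    (hf : IsLipschitzFor p L f) (hX : AEMeasurable X μ) (hp : Integrable (fun ω => p (X ω)) μ) :
    Integrable (fun ω => f (X ω)) μ :=
  ((integrable_const |f 0|).add (hp.const_mul L)).mono'
    (hf.continuous.measurable.comp_aemeasurable hX).aestronglyMeasurable
    (.of_forall fun ω => hf.abs_apply_le (X ω))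

end Continuous

/-- The ball of radius `t` of the dual norm of `p`, a set of vectors acting by the dot product. -/
def dualBall {κ : Type*} [Fintype κ] (p : Seminorm ℝ (κ → ℝ)) (t : ℝ) : Set (κ → ℝ) :=
  {z | ∀ x, z ⬝ᵥ x ≤ t * p x}

section DualBall

variable {κ : Type*} [Fintype κ] {p : Seminorm ℝ (κ → ℝ)} {t : ℝ}

theorem exists_subset_dualBall (hp : ∀ x, p x = 0 → x = 0) {K : Set (κ → ℝ)}
    (hK : IsCompact K) : ∃ L, 0 ≤ L ∧ K ⊆ dualBall p L := by
  obtain ⟨c, hc, hcp⟩ := exists_norm_map_le_mul_seminorm hp LinearMap.id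
  obtain ⟨R, hR⟩ := hK.exists_bound_of_continuousOn (f := fun a => ∑ i, |a i|) (by fun_prop)
  refine ⟨max R 0 * c, by positivity, fun a ha x => ?_⟩
  calc a ⬝ᵥ x ≤ ∑ i, |a i| * ‖x‖ := Finset.sum_le_sum fun i _ => by
        grw [← norm_le_pi_norm x i, Real.norm_eq_abs, ← abs_mul]
        exact le_abs_self _
    _ = (∑ i, |a i|) * ‖x‖ := (Finset.sum_mul ..).symm
    _ ≤ max R 0 * (c * p x) := by
        gcongr
        · exact (le_abs_self _).trans ((hR a ha).trans (le_max_left _ _))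
        · exact hcp x
    _ = max R 0 * c * p x := (mul_assoc ..).symm

theorem convexOn_dotProduct_left {D : Set (κ → ℝ)} (hD : Convex ℝ D) (x : κ → ℝ) :
    ConvexOn ℝ D (· ⬝ᵥ x) := by
  simp only [dotProduct_comm _ x]
  exact (dotProductBilin ℝ ℝ x).convexOn hD

theorem convex_dualBall : Convex ℝ (dualBall p t) := by
  rw [dualBall, Set.ofPred_forall]
  exact convex_iInter fun x => by
    simpa using (convexOn_dotProduct_left convex_univ x).convex_le (t * p x)

theorem isCompact_dualBall : IsCompact (dualBall p t) := by
  classical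
  have hclosed : IsClosed (dualBall p t) := by
    rw [dualBall, Set.ofPred_forall]
    exact isClosed_iInter fun x => isClosed_le (continuous_id.dotProduct continuous_const)
      continuous_const
  refine (isCompact_univ_pi fun i => isCompact_Icc
    (a := -(t * p (Pi.single i 1))) (b := t * p (Pi.single i 1))).of_isClosed_subset hclosed
      fun z hz i _ => ⟨?_, by simpa using hz (Pi.single i 1)⟩
  have := hz (-Pi.single i 1)
  rw [map_neg_eq_map, dotProduct_neg, dotProduct_single_one] at this
  linarith

theorem neg_mem_dualBall {z : κ → ℝ} (hz : z ∈ dualBall p t) : -z ∈ dualBall p t := fun x => by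
  simpa using hz (-x)

theorem exists_mem_dualBall_dotProduct_eq (p : Seminorm ℝ (κ → ℝ)) (ht : 0 ≤ t) (x : κ → ℝ) :
    ∃ z ∈ dualBall p t, z ⬝ᵥ x = t * p x := by
  classical
  let φ : (κ → ℝ) →ₗ.[ℝ] ℝ := LinearPMap.mkSpanSingleton' x (t * p x) fun (c : ℝ) hc => by
    change c • (t * p x) = 0
    have : ‖c‖ * p x = 0 := by rw [← map_smul_eq_mul, hc, map_zero]
    rcases mul_eq_zero.1 this with hc | hx
    · rw [norm_eq_zero.1 hc, zero_smul]
    · rw [hx, mul_zero, smul_zero]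
  obtain ⟨g, hgφ, hgp⟩ := exists_extension_of_le_sublinear φ (fun y => t * p y)
    (fun c hc y => by rw [map_smul_eq_mul, Real.norm_of_nonneg hc.le, mul_left_comm])
    (fun y z => by grw [map_add_le_add, mul_add]) fun ⟨y, hy⟩ => by
      obtain ⟨c, rfl⟩ := Submodule.mem_span_singleton.1 hy
      rw [LinearPMap.mkSpanSingleton'_apply, map_smul_eq_mul, smul_eq_mul, mul_left_comm]
      gcongr
      exact le_abs_self c
  have hz : ∀ y, (dotProductEquiv ℝ κ).symm g ⬝ᵥ y = g y := fun y => by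
    rw [← dotProductEquiv_apply_apply ℝ κ, LinearEquiv.apply_symm_apply]
  refine ⟨(dotProductEquiv ℝ κ).symm g, fun y => (hz y).trans_le (hgp y), (hz x).trans ?_⟩
  rw [hgφ ⟨x, Submodule.mem_span_singleton_self x⟩]
  exact LinearPMap.mkSpanSingleton'_apply_self ..

theorem dualNorm_le_iff {m : ℕ} {p : Seminorm ℝ (Fin m → ℝ)} (hp : ∀ x, p x = 0 → x = 0)
    {z : Fin m → ℝ} : dualNorm p z ≤ t ↔ 0 ≤ t ∧ z ∈ dualBall p t := by
  obtain ⟨L, hL, hzL⟩ := exists_subset_dualBall hp (isCompact_singleton (x := z))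
  have hbdd : BddAbove {r : ℝ | ∃ ξ : Fin m → ℝ, p ξ ≤ 1 ∧ r = z ⬝ᵥ ξ} := by
    refine ⟨L, ?_⟩
    rintro _ ⟨ξ, hξ, rfl⟩
    exact (hzL rfl ξ).trans (mul_le_of_le_one_right hL hξ)
  constructor
  · refine fun h => ⟨(le_csSup hbdd ⟨0, by simp, by simp⟩).trans h, fun x => ?_⟩
    rcases (apply_nonneg p x).eq_or_lt with hx | hx
    · simp [hp x hx.symm]
    · have := (le_csSup hbdd ⟨(p x)⁻¹ • x, ?_, rfl⟩).trans h
      · rwa [dotProduct_smul, smul_eq_mul, inv_mul_le_iff₀' hx] at this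
      · rw [map_smul_eq_mul, norm_inv, Real.norm_of_nonneg hx.le, inv_mul_cancel₀ hx.ne']
  · rintro ⟨ht, hz⟩
    refine csSup_le ⟨_, 0, by simp, rfl⟩ ?_
    rintro _ ⟨ξ, hξ, rfl⟩
    exact (hz ξ).trans (mul_le_of_le_one_right ht hξ)

theorem dualNorm_sub_comm {m : ℕ} (p : Seminorm ℝ (Fin m → ℝ)) (y z : Fin m → ℝ) :
    dualNorm p (y - z) = dualNorm p (z - y) := by
  have hle : ∀ y z r, (∃ ξ, p ξ ≤ 1 ∧ r = (y - z) ⬝ᵥ ξ) → ∃ ξ, p ξ ≤ 1 ∧ r = (z - y) ⬝ᵥ ξ := by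
    rintro y z _ ⟨ξ, hξ, rfl⟩
    exact ⟨-ξ, (map_neg_eq_map p ξ).trans_le hξ, by rw [dotProduct_neg, ← neg_dotProduct, neg_sub]⟩
  exact congrArg sSup (Set.ext fun r => ⟨hle y z r, hle z y r⟩)

end DualBall

end Seminorm

/-- The cone `ξ ↦ s + t * p (ξ - x₀)` with slope `t ≥ 0` and apex `(x₀, s)` majorizes the loss `f`
on `S`: the constraint that the dual of the worst-case expectation problem imposes on the
multiplier `t` and on the value `s` of the sample point `x₀`. -/
def IsConeMajorant {E : Type*} [AddCommGroup E] [Module ℝ E] (p : Seminorm ℝ E) (S : Set E)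
    (f : E → ℝ) (x₀ : E) (t s : ℝ) : Prop :=
  0 ≤ t ∧ ∀ ξ ∈ S, f ξ ≤ s + t * p (ξ - x₀)

section ConeMajorant

theorem isConeMajorant_iff_forall {E ι : Type*} [AddCommGroup E] [Module ℝ E] {p : Seminorm ℝ E}
    {S : Set E} {K : Set ι} {f : E → ℝ} {g : ι → E → ℝ} (hK : K.Nonempty)
    (hf : ∀ ξ ∈ S, IsGreatest ((g · ξ) '' K) (f ξ)) (x₀ : E) (t s : ℝ) :
    IsConeMajorant p S f x₀ t s ↔ ∀ i ∈ K, IsConeMajorant p S (g i) x₀ t s := by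
  refine ⟨fun h i hi => ⟨h.1, fun ξ hξ => ((hf ξ hξ).2 ⟨i, hi, rfl⟩).trans (h.2 ξ hξ)⟩,
    fun h => ⟨(h _ hK.some_mem).1, fun ξ hξ => ?_⟩⟩
  obtain ⟨i, hi, hfi⟩ := (hf ξ hξ).1
  exact hfi ▸ (h i hi).2 ξ hξ

theorem isConeMajorant_iff_exists {E F : Type*} [NormedAddCommGroup E] [NormedSpace ℝ E]
    [FiniteDimensional ℝ E] [AddCommGroup F] [Module ℝ F] [TopologicalSpace F]
    [IsTopologicalAddGroup F] [ContinuousSMul ℝ F] {p : Seminorm ℝ E} {S : Set E} {Y : Set F}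
    {f : E → ℝ} {g : F → E → ℝ} (hYc : IsCompact Y) (hY : Convex ℝ Y) (hYne : Y.Nonempty)
    (hS : Convex ℝ S) (hgY : ∀ ξ ∈ S, LowerSemicontinuousOn (g · ξ) Y)
    (hgY' : ∀ ξ ∈ S, ConvexOn ℝ Y (g · ξ)) (hgS : ∀ y ∈ Y, UpperSemicontinuousOn (g y) S)
    (hgS' : ∀ y ∈ Y, ConcaveOn ℝ S (g y)) (hf : ∀ ξ ∈ S, IsLeast ((g · ξ) '' Y) (f ξ)) (x₀ : E)
    (t s : ℝ) :
    IsConeMajorant p S f x₀ t s ↔ ∃ y ∈ Y, IsConeMajorant p S (g y) x₀ t s := by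
  constructor
  · rintro ⟨ht, h⟩
    have hcone : ConvexOn ℝ S fun ξ => t * p (ξ - x₀) := by
      simpa [sub_eq_add_neg] using
        ((p.convexOn.translate_left (-x₀)).smul ht).subset (Set.subset_univ S) hS
    have hcone' : Continuous fun ξ => -(t * p (ξ - x₀)) :=
      (((continuous_seminorm p).comp (continuous_sub_right x₀)).const_mul t).neg
    obtain ⟨y, hy, hle⟩ := exists_forall_le_of_forall_exists_le
      (f := fun y ξ => g y ξ + -(t * p (ξ - x₀))) (s := s) hYc hY hYne hS
      (fun ξ hξ => (hgY ξ hξ).add lowerSemicontinuousOn_const)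
      (fun ξ hξ => ((hgY' ξ hξ).add_const _).quasiconvexOn)
      (fun y hy => (hgS y hy).add hcone'.continuousOn.upperSemicontinuousOn)
      (fun y hy => ((hgS' y hy).add hcone.neg).quasiconcaveOn) fun ξ hξ => by
        obtain ⟨y, hy, hyf⟩ := (hf ξ hξ).1
        exact ⟨y, hy, by linarith [h ξ hξ]⟩
    exact ⟨y, hy, ht, fun ξ hξ => by linarith [hle ξ hξ]⟩
  · rintro ⟨y, hy, ht, h⟩
    exact ⟨ht, fun ξ hξ => ((hf ξ hξ).2 ⟨y, hy, rfl⟩).trans (h ξ hξ)⟩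

theorem IsConeMajorant.exists_mem_dualBall {κ : Type*} [Fintype κ] {p : Seminorm ℝ (κ → ℝ)}
    {S : Set (κ → ℝ)} {f : (κ → ℝ) → ℝ} {x₀ : κ → ℝ} {t s : ℝ}
    (h : IsConeMajorant p S f x₀ t s) (hf : ConcaveOn ℝ S f) (hfc : UpperSemicontinuousOn f S) :
    ∃ z ∈ dualBall p t, ∀ ξ ∈ S, f ξ ≤ s + z ⬝ᵥ (ξ - x₀) := by
  obtain ⟨z₀, hz₀, -⟩ := exists_mem_dualBall_dotProduct_eq p h.1 0
  obtain ⟨z, hz, hle⟩ := exists_forall_le_of_forall_exists_le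
    (f := fun z ξ => z ⬝ᵥ (x₀ - ξ) + f ξ) (s := s) isCompact_dualBall convex_dualBall ⟨z₀, hz₀⟩
    hf.1 (fun ξ _ => ContinuousOn.lowerSemicontinuousOn (by fun_prop))
    (fun ξ _ => ((convexOn_dotProduct_left convex_dualBall _).add_const _).quasiconvexOn)
    (fun z _ => (ContinuousOn.upperSemicontinuousOn (by fun_prop)).add hfc)
    (fun z _ => by
      simp only [dotProduct_sub]
      exact (((concaveOn_const _ hf.1).sub ((dotProductBilin ℝ ℝ z).convexOn hf.1)).add
        hf).quasiconcaveOn) fun ξ hξ => by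
      obtain ⟨z, hz, hzξ⟩ := exists_mem_dualBall_dotProduct_eq p h.1 (ξ - x₀)
      exact ⟨z, hz, by rw [← neg_sub ξ, dotProduct_neg]; linarith [h.2 ξ hξ]⟩
  exact ⟨z, hz, fun ξ hξ => by
    have := hle ξ hξ
    rw [← neg_sub ξ, dotProduct_neg] at this
    linarith⟩

variable {m l : ℕ} {p : Seminorm ℝ (Fin m → ℝ)} {C : Matrix (Fin l) (Fin m) ℝ} {d : Fin l → ℝ}

theorem convex_polyhedron : Convex ℝ (polyhedron C d) :=
  (convex_Iic d).linear_preimage C.mulVecLin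

theorem isConeMajorant_affine_iff (hp : ∀ x, p x = 0 → x = 0) {x₀ : Fin m → ℝ}
    (hx₀ : x₀ ∈ polyhedron C d) (b : ℝ) (a : Fin m → ℝ) (t s : ℝ) :
    IsConeMajorant p (polyhedron C d) (fun ξ => b + a ⬝ᵥ ξ) x₀ t s ↔
      ∃ γ, b + a ⬝ᵥ x₀ + γ ⬝ᵥ (d - C *ᵥ x₀) ≤ s ∧ dualNorm p (Cᵀ *ᵥ γ - a) ≤ t ∧ 0 ≤ γ := by
  constructor
  · intro h
    obtain ⟨z, hz, hle⟩ := h.exists_mem_dualBall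
      ((concaveOn_const b convex_polyhedron).add
        ((dotProductBilin ℝ ℝ a).concaveOn convex_polyhedron))
      (ContinuousOn.upperSemicontinuousOn (by fun_prop))
    obtain ⟨γ, hγ, hγa, hγd⟩ := affine_farkas (c := a - z) (δ := s - b - z ⬝ᵥ x₀) ⟨x₀, hx₀⟩
      fun ξ hξ => by
        have := hle ξ hξ
        rw [dotProduct_sub] at this
        rw [sub_dotProduct]
        linarith
    refine ⟨γ, ?_, (dualNorm_le_iff hp).2 ⟨h.1, ?_⟩, hγ⟩
    · rw [dotProduct_sub, ← transpose_mulVec_dotProduct, hγa, sub_dotProduct]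
      linarith
    · rw [hγa, sub_sub_cancel_left]
      exact neg_mem_dualBall hz
  · rintro ⟨γ, hs, hγt, hγ⟩
    obtain ⟨ht, hz⟩ := (dualNorm_le_iff hp).1 hγt
    refine ⟨ht, fun ξ hξ => ?_⟩
    have hγξ : (Cᵀ *ᵥ γ) ⬝ᵥ ξ ≤ γ ⬝ᵥ d := by
      rw [transpose_mulVec_dotProduct]
      exact dotProduct_le_dotProduct_of_nonneg_left hξ hγ
    have hzξ := neg_mem_dualBall hz (ξ - x₀)
    rw [neg_sub, sub_dotProduct, dotProduct_sub, dotProduct_sub] at hzξ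
    rw [dotProduct_sub, ← transpose_mulVec_dotProduct] at hs
    linarith

end ConeMajorant

section LagrangeMultiplier

theorem exists_multiplier {A : Set (ℝ × ℝ)} {ε L M v₀ : ℝ} (hA : Convex ℝ A) (hε : 0 ≤ ε)
    (hL : 0 ≤ L) (h₀ : (0, v₀) ∈ A) (hAL : ∀ z ∈ A, z.2 ≤ v₀ + L * z.1)
    (hM : ∀ z ∈ A, z.1 ≤ ε → z.2 ≤ M) : ∃ t, 0 ≤ t ∧ ∀ z ∈ A, z.2 ≤ M + t * (z.1 - ε) := by
  obtain ⟨t, ht, hle⟩ := exists_forall_le_of_forall_exists_le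
    (f := fun t (z : ℝ × ℝ) => t * (ε - z.1) + z.2) (s := M) isCompact_Icc (convex_Icc 0 L)
    (Set.nonempty_Icc.2 hL) hA
    (fun z _ => ContinuousOn.lowerSemicontinuousOn (by fun_prop))
    (fun z _ => (((LinearMap.toSpanSingleton ℝ ℝ (ε - z.1)).convexOn
      (convex_Icc 0 L)).add_const z.2).quasiconvexOn)
    (fun t _ => ContinuousOn.upperSemicontinuousOn (by fun_prop))
    (fun t _ => by
      simp only [mul_sub, sub_add_eq_add_sub, add_sub_assoc]
      exact ((concaveOn_const (t * ε) hA).add ((LinearMap.snd ℝ ℝ ℝ -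
        t • LinearMap.fst ℝ ℝ ℝ).concaveOn hA)).quasiconcaveOn)
    fun ⟨c, v⟩ hz => by
      rcases le_or_gt c ε with hc | hc
      · exact ⟨0, Set.left_mem_Icc.2 hL, by simpa using hM _ hz hc⟩
      refine ⟨L, Set.right_mem_Icc.2 hL, ?_⟩
      -- Mixing `(c, v)` with `(0, v₀)` exhausts the budget `ε`.
      have hc₀ : 0 < c := hε.trans_lt hc
      have hmix := hM _ (hA h₀ hz (sub_nonneg.2 ((div_le_one hc₀).2 hc.le))
        (div_nonneg hε hc₀.le) (sub_add_cancel 1 (ε / c))) (by simp [hc₀.ne'])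
      have := mul_le_mul_of_nonneg_left (hAL _ hz) (sub_nonneg.2 ((div_le_one hc₀).2 hc.le))
      have hcε : ε / c * c = ε := div_mul_cancel₀ ε hc₀.ne'
      simp only [Prod.snd_add, Prod.smul_snd, smul_eq_mul] at hmix this
      linear_combination hmix + this - L * hcε
  exact ⟨t, ht.1, fun z hz => by linarith [hle z hz]⟩

end LagrangeMultiplier

section DiracAverage

/-- The uniform average of the Dirac measures at the points `x i`; `empirical` is the case of a
sample of vectors, but discrete transport plans need the average on a product space. -/
noncomputable def diracAverage {Ω : Type*} [MeasurableSpace Ω] {N : ℕ} (x : Fin N → Ω) :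
    Measure Ω :=
  (N : ℝ≥0∞)⁻¹ • ∑ i, Measure.dirac (x i)

variable {Ω Ω' : Type*} [MeasurableSpace Ω] [MeasurableSpace Ω'] {N : ℕ}

instance isProbabilityMeasure_diracAverage [NeZero N] (x : Fin N → Ω) :
    IsProbabilityMeasure (diracAverage x) := by
  refine ⟨?_⟩
  simp only [diracAverage, Measure.smul_apply, Measure.coe_finsetSum, Finset.sum_apply,
    measure_univ, Finset.sum_const, Finset.card_univ, Fintype.card_fin, smul_eq_mul, nsmul_eq_mul,
    mul_one]
  exact ENNReal.inv_mul_cancel (by simp [NeZero.ne N]) (by simp)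

theorem map_diracAverage (x : Fin N → Ω) {g : Ω → Ω'} (hg : Measurable g) :
    (diracAverage x).map g = diracAverage (g ∘ x) := by
  simp [diracAverage, Measure.map_finset_sum hg.aemeasurable, Measure.map_dirac' hg]

variable [MeasurableSingletonClass Ω]

theorem ae_diracAverage {P : Ω → Prop} {x : Fin N → Ω} (h : ∀ i, P (x i)) :
    ∀ᵐ ω ∂diracAverage x, P ω := by
  refine Measure.ae_smul_measure ?_ _
  rw [ae_iff]
  simp [h]

theorem integral_diracAverage (x : Fin N → Ω) (g : Ω → ℝ) :
    ∫ ω, g ω ∂diracAverage x = 1 / (N : ℝ) * ∑ i, g (x i) := by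
  rw [diracAverage, integral_smul_measure,
    integral_finsetSum_measure fun i _ => integrable_dirac (by simp)]
  simp

theorem integrable_diracAverage [NeZero N] (x : Fin N → Ω) (g : Ω → ℝ) :
    Integrable g (diracAverage x) :=
  (integrable_finsetSum_measure.2 fun i _ => integrable_dirac (by simp)).smul_measure
    (ENNReal.inv_ne_top.2 (by simp [NeZero.ne N]))

end DiracAverage

section TransportPlan

variable {m : ℕ}

/-- The expected cost of transporting mass along `π`, for the cost `p (ξ₁ - ξ₂)`. -/
noncomputable def transportCost (p : Seminorm ℝ (Fin m → ℝ))
    (π : Measure ((Fin m → ℝ) × (Fin m → ℝ))) : ℝ :=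
  ∫ x, p (x.1 - x.2) ∂π

/-- The plans that transport the distribution `P` into `S` at finite expected cost. -/
def transportPlans (p : Seminorm ℝ (Fin m → ℝ)) (P : Measure (Fin m → ℝ)) (S : Set (Fin m → ℝ)) :
    Set (Measure ((Fin m → ℝ) × (Fin m → ℝ))) :=
  {π | π.map Prod.fst = P ∧ (∀ᵐ x ∂π, x.2 ∈ S) ∧ Integrable (fun x => p (x.1 - x.2)) π}

variable {p : Seminorm ℝ (Fin m → ℝ)} {P Q : Measure (Fin m → ℝ)} {S : Set (Fin m → ℝ)}
  {π π' : Measure ((Fin m → ℝ) × (Fin m → ℝ))} {f g : (Fin m → ℝ) → ℝ} {ε ε' t L : ℝ}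

theorem isProbabilityMeasure_of_mem_transportPlans [IsProbabilityMeasure P]
    (hπ : π ∈ transportPlans p P S) : IsProbabilityMeasure π :=
  (Measure.isProbabilityMeasure_map_iff measurable_fst.aemeasurable).1 (hπ.1 ▸ inferInstance)

theorem diracAverage_prodMk_mem_transportPlans {N : ℕ} [NeZero N] (x : Fin N → Fin m → ℝ)
    {y : Fin N → Fin m → ℝ} (hy : ∀ i, y i ∈ S) :
    diracAverage (fun i => (x i, y i)) ∈ transportPlans p (diracAverage x) S :=
  ⟨map_diracAverage _ measurable_fst, ae_diracAverage hy, integrable_diracAverage _ _⟩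

theorem smul_add_smul_mem_transportPlans (hπ : π ∈ transportPlans p P S)
    (hπ' : π' ∈ transportPlans p P S) {a b : NNReal} (hab : a + b = 1) :
    a • π + b • π' ∈ transportPlans p P S := by
  refine ⟨?_, ae_add_measure_iff.2 ⟨Measure.ae_smul_measure hπ.2.1 _,
    Measure.ae_smul_measure hπ'.2.1 _⟩, hπ.2.2.smul_measure_nnreal.add_measure
    hπ'.2.2.smul_measure_nnreal⟩
  rw [Measure.map_add _ _ measurable_fst, Measure.map_smul, Measure.map_smul, hπ.1, hπ'.1,
    ← add_smul, hab, one_smul]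

theorem convex_image_transportPlans
    (hf : ∀ π ∈ transportPlans p P S, Integrable (fun x => f x.2) π) :
    Convex ℝ ((fun π => (transportCost p π, ∫ x, f x.2 ∂π)) '' transportPlans p P S) := by
  rintro _ ⟨π, hπ, rfl⟩ _ ⟨π', hπ', rfl⟩ a b ha hb hab
  lift a to NNReal using ha
  lift b to NNReal using hb
  refine ⟨a • π + b • π', smul_add_smul_mem_transportPlans hπ hπ' (by exact_mod_cast hab), ?_⟩
  have hval : ∀ g : (Fin m → ℝ) × (Fin m → ℝ) → ℝ, Integrable g π → Integrable g π' →
      ∫ x, g x ∂(a • π + b • π') = a • ∫ x, g x ∂π + b • ∫ x, g x ∂π' := fun g h h' => by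
    rw [integral_add_measure h.smul_measure_nnreal h'.smul_measure_nnreal,
      integral_smul_nnreal_measure, integral_smul_nnreal_measure]
  exact Prod.ext (hval _ hπ.2.2 hπ'.2.2) (hval _ (hf π hπ) (hf π' hπ'))

theorem integrable_seminorm_snd (hP : Integrable p P) (hπ : π ∈ transportPlans p P S) :
    Integrable (fun x => p x.2) π := by
  have hfst : Integrable (fun x => p x.1) π :=
    Integrable.comp_measurable (g := p) (hπ.1 ▸ hP) measurable_fst
  refine (hfst.add hπ.2.2).mono'
    ((continuous_seminorm p).comp continuous_snd).aestronglyMeasurable (.of_forall fun x => ?_)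
  rw [Real.norm_of_nonneg (apply_nonneg p _)]
  simpa using map_sub_le_add p x.1 (x.1 - x.2)

theorem IsLipschitzFor.integrable_snd [IsProbabilityMeasure P] (hf : IsLipschitzFor p L f)
    (hP : Integrable p P) (hπ : π ∈ transportPlans p P S) : Integrable (fun x => f x.2) π :=
  have := isProbabilityMeasure_of_mem_transportPlans hπ
  hf.integrable_comp measurable_snd.aemeasurable (integrable_seminorm_snd hP hπ)

theorem ofReal_transportCost (hπ : Integrable (fun x => p (x.1 - x.2)) π) :
    ENNReal.ofReal (transportCost p π) = ∫⁻ x, ENNReal.ofReal (p (x.1 - x.2)) ∂π :=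
  ofReal_integral_eq_lintegral_ofReal hπ (.of_forall fun _ => apply_nonneg p _)

theorem map_snd_mem_wassersteinBall [IsProbabilityMeasure P] (hS : MeasurableSet S)
    (hP : Integrable p P) (hπ : π ∈ transportPlans p P S) (hε : transportCost p π ≤ ε) :
    π.map Prod.snd ∈ wassersteinBall p S P ε := by
  have := isProbabilityMeasure_of_mem_transportPlans hπ
  refine ⟨⟨Measure.isProbabilityMeasure_map measurable_snd.aemeasurable,
    (ae_map_iff measurable_snd.aemeasurable hS).2 hπ.2.1, ?_⟩, ?_⟩
  · rw [lintegral_map (continuous_seminorm p).measurable.ennreal_ofReal measurable_snd]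
    exact (integrable_seminorm_snd hP hπ).lintegral_lt_top
  · refine (iInf₂_le π ⟨hπ.1, rfl⟩).trans ?_
    rw [← ofReal_transportCost hπ.2.2]
    exact ENNReal.ofReal_le_ofReal hε

theorem exists_mem_transportPlans_of_mem_wassersteinBall (hQ : Q ∈ wassersteinBall p S P ε)
    (hε : 0 ≤ ε) (hεε' : ε < ε') :
    ∃ π ∈ transportPlans p P S, π.map Prod.snd = Q ∧ transportCost p π ≤ ε' := by
  have hlt := hQ.2.trans_lt ((ENNReal.ofReal_lt_ofReal_iff (hε.trans_lt hεε')).2 hεε')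
  simp only [wasserstein, iInf_lt_iff] at hlt
  obtain ⟨π, ⟨hP, rfl⟩, hcost⟩ := hlt
  have hint : Integrable (fun x => p (x.1 - x.2)) π :=
    (lintegral_ofReal_ne_top_iff_integrable ((continuous_seminorm p).comp
      (continuous_fst.sub continuous_snd)).aestronglyMeasurable
      (.of_forall fun _ => apply_nonneg p _)).1 (hcost.trans ENNReal.ofReal_lt_top).ne
  refine ⟨π, ⟨hP, ae_of_ae_map (p := (· ∈ S)) measurable_snd.aemeasurable hQ.1.2.1, hint⟩, rfl, ?_⟩
  rw [← ofReal_transportCost hint] at hcost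
  exact ((ENNReal.ofReal_lt_ofReal_iff (hε.trans_lt hεε')).1 hcost).le

theorem integral_snd_le_of_isConeMajorant (hf : Integrable (fun x => f x.2) π)
    (hg : Integrable g P) (hπ : π ∈ transportPlans p P S)
    (h : ∀ x, IsConeMajorant p S f x t (g x)) :
    ∫ x, f x.2 ∂π ≤ ∫ x, g x ∂P + t * transportCost p π := by
  have hg' : Integrable (fun x => g x.1) π :=
    Integrable.comp_measurable (g := g) (hπ.1 ▸ hg) measurable_fst
  calc ∫ x, f x.2 ∂π ≤ ∫ x, (g x.1 + t * p (x.1 - x.2)) ∂π := by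
        refine integral_mono_ae hf (hg'.add (hπ.2.2.const_mul t)) ?_
        filter_upwards [hπ.2.1] with x hx
        exact map_sub_rev p x.1 x.2 ▸ (h x.1).2 x.2 hx
    _ = ∫ x, g x ∂P + t * transportCost p π := by
        rw [integral_add hg' (hπ.2.2.const_mul t), integral_const_mul, transportCost, ← hπ.1,
          integral_map measurable_fst.aemeasurable (hπ.1 ▸ hg.aestronglyMeasurable)]

end TransportPlan

section Expectation

variable {m : ℕ} {p : Seminorm ℝ (Fin m → ℝ)} {S : Set (Fin m → ℝ)} {Q : Measure (Fin m → ℝ)}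
  {f : (Fin m → ℝ) → ℝ}

theorem expectation_coe (hf : Integrable f Q) :
    expectation Q (fun ξ => (f ξ : EReal)) = ((∫ ξ, f ξ ∂Q : ℝ) : EReal) := by
  have hpos : ∫⁻ ξ, ENNReal.ofReal (f ξ) ∂Q ≠ ∞ := hf.lintegral_lt_top.ne
  have hneg : ∫⁻ ξ, ENNReal.ofReal (-f ξ) ∂Q ≠ ∞ := hf.neg.lintegral_lt_top.ne
  simp only [expectation, ← EReal.coe_neg, EReal.toENNReal_of_ne_top (EReal.coe_ne_top _),
    EReal.toReal_coe]
  rw [if_neg hpos, integral_eq_lintegral_pos_part_sub_lintegral_neg_part hf, EReal.coe_sub,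
    EReal.coe_ennreal_toReal hpos, EReal.coe_ennreal_toReal hneg]

theorem integrable_of_mem_distributions (hQ : Q ∈ distributions p S) : Integrable p Q :=
  (lintegral_ofReal_ne_top_iff_integrable (continuous_seminorm p).aestronglyMeasurable
    (.of_forall fun _ => apply_nonneg p _)).1 hQ.2.2.ne

end Expectation

section Duality

theorem isConeMajorant_ciInf {E ι : Type*} [AddCommGroup E] [Module ℝ E] [Nonempty ι]
    {p : Seminorm ℝ E} {S : Set E} {f : E → ℝ} {x₀ : ι → E} {t : ℝ} {s : ι → ℝ}
    (h : ∀ i, IsConeMajorant p S f (x₀ i) t (s i)) (x : E) :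
    IsConeMajorant p S f x t (⨅ i, (s i + t * p (x - x₀ i))) := by
  have ht : 0 ≤ t := (h (Classical.arbitrary ι)).1
  refine ⟨ht, fun ξ hξ => sub_le_iff_le_add.1 (le_ciInf fun i => ?_)⟩
  have htri := mul_le_mul_of_nonneg_left (map_add_le_add p (ξ - x) (x - x₀ i)) ht
  rw [sub_add_sub_cancel] at htri
  linarith [(h i).2 ξ hξ]

theorem sum_ciSup_le {ι κ : Type*} [Fintype ι] [Nonempty κ] {g : ι → κ → ℝ} {B : ℝ}
    (h : ∀ x : ι → κ, ∑ i, g i (x i) ≤ B) :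
    (∀ i, BddAbove (Set.range (g i))) ∧ ∑ i, ⨆ x, g i x ≤ B := by
  classical
  have hbdd : ∀ i, BddAbove (Set.range (g i)) := fun i => by
    obtain ⟨x₀⟩ := ‹Nonempty κ›
    refine ⟨B - ∑ j ∈ Finset.univ.erase i, g j x₀, Set.forall_mem_range.2 fun x => ?_⟩
    have := h (Function.update (fun _ => x₀) i x)
    rw [← Finset.add_sum_erase _ _ (Finset.mem_univ i), Function.update_self,
      Finset.sum_congr rfl fun j hj => by
        rw [Function.update_of_ne (Finset.ne_of_mem_erase hj)]] at this
    linarith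
  refine ⟨hbdd, ?_⟩
  choose u _ hu hu' using fun i => exists_seq_tendsto_sSup (Set.range_nonempty (g i)) (hbdd i)
  choose x hx using hu'
  refine le_of_tendsto' (tendsto_finsetSum _ fun i _ => hu i) fun k => ?_
  simpa only [hx] using h fun i => x i k

variable {m N : ℕ} [NeZero N] {p : Seminorm ℝ (Fin m → ℝ)} {S : Set (Fin m → ℝ)}
  {xi : Fin N → Fin m → ℝ} {f : (Fin m → ℝ) → ℝ} {ε L : ℝ}

theorem worstCaseExpectation_le (hf : IsLipschitzFor p L f) (hε : 0 ≤ ε) {t : ℝ} {s : Fin N → ℝ}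
    (h : ∀ i, IsConeMajorant p S f (xi i) t (s i)) :
    worstCaseExpectation p S xi ε (fun ξ => (f ξ : EReal))
      ≤ ((t * ε + 1 / (N : ℝ) * ∑ i, s i : ℝ) : EReal) := by
  refine iSup₂_le fun Q hQ => ?_
  have hQprob : IsProbabilityMeasure Q := hQ.1.1
  have hp : Integrable p (diracAverage xi) := integrable_diracAverage xi p
  have hfQ : Integrable f Q :=
    hf.integrable_comp aemeasurable_id (integrable_of_mem_distributions hQ.1)
  rw [expectation_coe hfQ, EReal.coe_le_coe_iff]
  have hlim : Filter.Tendsto (fun ε' => t * ε' + 1 / (N : ℝ) * ∑ i, s i) (nhdsWithin ε (Set.Ioi ε))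
      (nhds (t * ε + 1 / (N : ℝ) * ∑ i, s i)) :=
    Continuous.continuousWithinAt (by fun_prop)
  refine ge_of_tendsto hlim (eventually_nhdsWithin_of_forall fun ε' hε' => ?_)
  obtain ⟨π, hπ, rfl, hcost⟩ := exists_mem_transportPlans_of_mem_wassersteinBall hQ hε hε'
  let g : (Fin m → ℝ) → ℝ := fun x => ⨅ i, (s i + t * p (x - xi i))
  have hgs : ∀ i, g (xi i) ≤ s i := fun i =>
    (ciInf_le (Set.finite_range _).bddBelow i).trans (by simp)
  calc ∫ ξ, f ξ ∂π.map Prod.snd = ∫ x, f x.2 ∂π :=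
        integral_map measurable_snd.aemeasurable hf.continuous.aestronglyMeasurable
    _ ≤ ∫ x, g x ∂diracAverage xi + t * transportCost p π :=
        integral_snd_le_of_isConeMajorant (hf.integrable_snd hp hπ)
          (integrable_diracAverage xi g) hπ (isConeMajorant_ciInf h)
    _ ≤ t * ε' + 1 / (N : ℝ) * ∑ i, s i := by
        rw [integral_diracAverage, add_comm]
        gcongr with i
        · exact (h 0).1
        · exact hgs i

theorem le_worstCaseExpectation (hf : IsLipschitzFor p L f) (hS : MeasurableSet S)
    {π : Measure ((Fin m → ℝ) × (Fin m → ℝ))} (hπ : π ∈ transportPlans p (diracAverage xi) S)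
    (hε : transportCost p π ≤ ε) :
    ((∫ x, f x.2 ∂π : ℝ) : EReal) ≤ worstCaseExpectation p S xi ε (fun ξ => (f ξ : EReal)) := by
  have hp : Integrable p (diracAverage xi) := integrable_diracAverage xi p
  have hint : Integrable f (π.map Prod.snd) :=
    (integrable_map_measure hf.continuous.aestronglyMeasurable measurable_snd.aemeasurable).2
      (hf.integrable_snd hp hπ)
  rw [← integral_map measurable_snd.aemeasurable hf.continuous.aestronglyMeasurable,
    ← expectation_coe hint]
  exact le_iSup₂ (f := fun Q _ => expectation Q _) _ (map_snd_mem_wassersteinBall hS hp hπ hε)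

theorem exists_multiplier_of_worstCaseExpectation_le (hf : IsLipschitzFor p L f) (hL : 0 ≤ L)
    (hS : MeasurableSet S) (hxi : ∀ i, xi i ∈ S) (hε : 0 ≤ ε) {M : ℝ}
    (hM : worstCaseExpectation p S xi ε (fun ξ => (f ξ : EReal)) ≤ M) :
    ∃ t, 0 ≤ t ∧ ∀ π ∈ transportPlans p (diracAverage xi) S,
      ∫ x, f x.2 ∂π ≤ M + t * (transportCost p π - ε) := by
  have hint : ∀ π ∈ transportPlans p (diracAverage xi) S, Integrable (fun x => f x.2) π :=
    fun π hπ => hf.integrable_snd (integrable_diracAverage xi p) hπ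
  have hLip : ∀ x, IsConeMajorant p S f x L (f x) := fun x =>
    ⟨hL, fun ξ _ => sub_le_iff_le_add'.1 (hf ξ x)⟩
  obtain ⟨t, ht, hle⟩ := exists_multiplier (v₀ := ∫ x, f x ∂diracAverage xi) (M := M)
    (convex_image_transportPlans hint) hε hL
    ⟨_, diracAverage_prodMk_mem_transportPlans xi hxi, Prod.ext
      (by simp [transportCost, integral_diracAverage]) (by simp only [integral_diracAverage])⟩
    (Set.forall_mem_image.2 fun π hπ => integral_snd_le_of_isConeMajorant (hint π hπ)
      (integrable_diracAverage xi f) hπ hLip)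
    (Set.forall_mem_image.2 fun π hπ hπε => EReal.coe_le_coe_iff.1
      ((le_worstCaseExpectation hf hS hπ hπε).trans hM))
  exact ⟨t, ht, fun π hπ => hle _ ⟨π, hπ, rfl⟩⟩

theorem exists_isConeMajorant_of_worstCaseExpectation_le (hf : IsLipschitzFor p L f) (hL : 0 ≤ L)
    (hS : MeasurableSet S) (hxi : ∀ i, xi i ∈ S) (hε : 0 ≤ ε) {M : ℝ}
    (hM : worstCaseExpectation p S xi ε (fun ξ => (f ξ : EReal)) ≤ M) :
    ∃ (t : ℝ) (s : Fin N → ℝ), (∀ i, IsConeMajorant p S f (xi i) t (s i)) ∧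
      t * ε + 1 / (N : ℝ) * ∑ i, s i ≤ M := by
  obtain ⟨t, ht, hle⟩ := exists_multiplier_of_worstCaseExpectation_le hf hL hS hxi hε hM
  have hN : (0 : ℝ) < N := by exact_mod_cast NeZero.pos N
  have hsum : ∀ x : Fin N → S, ∑ i, (f (x i) - t * p (x i - xi i)) ≤ N * (M - t * ε) := by
    intro x
    have := hle _ (diracAverage_prodMk_mem_transportPlans xi fun i => (x i).2)
    rw [transportCost, integral_diracAverage, integral_diracAverage] at this
    simp only [map_sub_rev p (xi _)] at this
    rw [Finset.sum_sub_distrib, ← Finset.mul_sum, ← div_le_iff₀' hN]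
    linear_combination this
  have : Nonempty S := ⟨⟨xi 0, hxi 0⟩⟩
  obtain ⟨hbdd, hB⟩ := sum_ciSup_le (g := fun i (ξ : S) => f ξ - t * p (ξ - xi i)) hsum
  refine ⟨t, _, fun i => ⟨ht, fun ξ hξ => sub_le_iff_le_add.1 (le_ciSup (hbdd i) ⟨ξ, hξ⟩)⟩, ?_⟩
  rw [← div_le_iff₀' hN] at hB
  linear_combination hB

theorem worstCaseExpectation_eq_iInf (hf : IsLipschitzFor p L f) (hL : 0 ≤ L)
    (hS : MeasurableSet S) (hxi : ∀ i, xi i ∈ S) (hε : 0 ≤ ε) :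
    worstCaseExpectation p S xi ε (fun ξ => (f ξ : EReal))
      = ⨅ (t : ℝ) (s : Fin N → ℝ) (_ : ∀ i, IsConeMajorant p S f (xi i) t (s i)),
        ((t * ε + 1 / (N : ℝ) * ∑ i, s i : ℝ) : EReal) := by
  refine le_antisymm (le_iInf₂ fun t s => le_iInf fun h => worstCaseExpectation_le hf hε h)
    (EReal.le_of_forall_lt_iff_le.1 fun M hM => ?_)
  obtain ⟨t, s, h, hle⟩ := exists_isConeMajorant_of_worstCaseExpectation_le hf hL hS hxi hε hM.le
  exact (iInf₂_le_of_le t s (iInf_le _ h)).trans (EReal.coe_le_coe_iff.2 hle)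

end Duality

section Recourse

theorem iInf_coe_eq_of_isLeast {α : Type*} {Y : Set α} {g : α → ℝ} {c : ℝ}
    (hc : IsLeast (g '' Y) c) : ⨅ y ∈ Y, (g y : EReal) = c := by
  obtain ⟨⟨y, hy, rfl⟩, hle⟩ := hc
  exact le_antisymm (iInf₂_le y hy)
    (le_iInf₂ fun z hz => EReal.coe_le_coe_iff.2 (hle ⟨z, hz, rfl⟩))

theorem isLeast_of_isGreatest_dualFeasible {n r : ℕ} {g : Fin r → ℝ} {q : Fin n → ℝ}
    {W : Matrix (Fin r) (Fin n) ℝ} {c : ℝ}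
    (hc : IsGreatest ((g ⬝ᵥ ·) '' dualFeasible q W) c) :
    IsLeast ((q ⬝ᵥ ·) '' {y | g ≤ W *ᵥ y}) c := by
  obtain ⟨⟨θ, hθ, rfl⟩, hmax⟩ := hc
  have hle : ∀ y, g ≤ W *ᵥ y → g ⬝ᵥ θ ≤ q ⬝ᵥ y := fun y hy => by
    rw [← hθ.2, transpose_mulVec_dotProduct, dotProduct_comm θ]
    exact dotProduct_le_dotProduct_of_nonneg_right hy hθ.1
  obtain ⟨y, hy, hyθ⟩ := exists_le_mulVec_and_dotProduct_le ⟨θ, hθ⟩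
    fun θ' h₁ h₂ => hmax ⟨θ', ⟨h₁, h₂⟩, rfl⟩
  exact ⟨⟨y, hy, hyθ.antisymm (hle y hy)⟩, Set.forall_mem_image.2 hle⟩

theorem exists_isGreatest_image_extremePoints {E : Type*} [AddCommGroup E] [Module ℝ E]
    [TopologicalSpace E] [T2Space E] [IsTopologicalAddGroup E] [ContinuousSMul ℝ E]
    [LocallyConvexSpace ℝ E] {D : Set E} (hD : IsCompact D) (hne : D.Nonempty)
    (φ : E →L[ℝ] ℝ) : ∃ c, IsGreatest (φ '' D.extremePoints ℝ) c ∧ IsGreatest (φ '' D) c := by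
  have hexp : IsExposed ℝ D (φ.toExposed D) := ContinuousLinearMap.toExposed.isExposed
  obtain ⟨x, hx, hmax⟩ := hD.exists_isMaxOn hne φ.continuous.continuousOn
  obtain ⟨v, hv⟩ := (hexp.isCompact hD).extremePoints_nonempty ⟨x, hx, fun y hy => hmax hy⟩
  have hvD : v ∈ D.extremePoints ℝ := hexp.isExtreme.extremePoints_subset_extremePoints hv
  have hub : φ v ∈ upperBounds (φ '' D) := Set.forall_mem_image.2 hv.1.2
  exact ⟨φ v, ⟨⟨v, hvD, rfl⟩, upperBounds_mono_set (Set.image_mono extremePoints_subset) hub⟩,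
    ⟨v, extremePoints_subset hvD, rfl⟩, hub⟩

theorem exists_isLipschitzFor_affine {κ ρ : Type*} [Fintype κ] [Fintype ρ]
    {p : Seminorm ℝ (κ → ℝ)} (hp : ∀ x, p x = 0 → x = 0) {K : Set (ρ → ℝ)} (hK : IsCompact K)
    (b : (ρ → ℝ) → ℝ) (A : Matrix κ ρ ℝ) :
    ∃ L, 0 ≤ L ∧ ∀ y ∈ K, IsLipschitzFor p L fun ξ => b y + (A *ᵥ y) ⬝ᵥ ξ := by
  obtain ⟨L, hL, hKL⟩ := exists_subset_dualBall hp
    (hK.image (continuous_const.matrix_mulVec continuous_id : Continuous fun y => A *ᵥ y))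
  refine ⟨L, hL, fun y hy ξ η => ?_⟩
  rw [add_sub_add_left_eq_sub, ← dotProduct_sub]
  exact hKL ⟨y, hy, rfl⟩ _

variable {m l n r N : ℕ} {p : Seminorm ℝ (Fin m → ℝ)} {C : Matrix (Fin l) (Fin m) ℝ}
  {d : Fin l → ℝ} {xi : Fin N → Fin m → ℝ} {ε : ℝ}

theorem measurableSet_polyhedron : MeasurableSet (polyhedron C d) :=
  (isClosed_le (continuous_const.matrix_mulVec continuous_id) continuous_const).measurableSet

theorem isConeMajorant_iff_exists_objective (hp : ∀ x, p x = 0 → x = 0)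
    {Q : Matrix (Fin n) (Fin m) ℝ} {W : Matrix (Fin r) (Fin n) ℝ} {h : Fin r → ℝ}
    (hne : {y | h ≤ W *ᵥ y}.Nonempty) (hY : IsCompact {y | h ≤ W *ᵥ y}) {f : (Fin m → ℝ) → ℝ}
    (hf : ∀ ξ, IsLeast ((· ⬝ᵥ (Q *ᵥ ξ)) '' {y | h ≤ W *ᵥ y}) (f ξ))
    {x₀ : Fin m → ℝ} (hx₀ : x₀ ∈ polyhedron C d) (t s : ℝ) :
    IsConeMajorant p (polyhedron C d) f x₀ t s ↔
      ∃ (γ : Fin l → ℝ) (y : Fin n → ℝ), y ⬝ᵥ (Q *ᵥ x₀) + γ ⬝ᵥ (d - C *ᵥ x₀) ≤ s ∧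
        h ≤ W *ᵥ y ∧ dualNorm p (Qᵀ *ᵥ y - Cᵀ *ᵥ γ) ≤ t ∧ 0 ≤ γ := by
  have hYconv : Convex ℝ {y | h ≤ W *ᵥ y} := (convex_Ici h).linear_preimage W.mulVecLin
  have hlinear : ∀ y : Fin n → ℝ, (fun ξ => y ⬝ᵥ (Q *ᵥ ξ)) = fun ξ => 0 + (Qᵀ *ᵥ y) ⬝ᵥ ξ :=
    fun y => funext fun ξ => by rw [transpose_mulVec_dotProduct, zero_add]
  rw [isConeMajorant_iff_exists (g := fun y ξ => y ⬝ᵥ (Q *ᵥ ξ)) hY hYconv hne convex_polyhedron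
    (fun ξ _ => ContinuousOn.lowerSemicontinuousOn (by fun_prop))
    (fun ξ _ => convexOn_dotProduct_left hYconv (Q *ᵥ ξ))
    (fun y _ => ContinuousOn.upperSemicontinuousOn (by fun_prop))
    (fun y _ => ((dotProductBilin ℝ ℝ y).comp Q.mulVecLin).concaveOn convex_polyhedron)
    fun ξ _ => hf ξ, exists_comm]
  simp only [hlinear, isConeMajorant_affine_iff hp hx₀, zero_add, transpose_mulVec_dotProduct,
    dualNorm_sub_comm p (Cᵀ *ᵥ _), Set.mem_ofPred_eq, ← exists_and_left, and_left_comm]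

theorem worstCaseExpectation_recourseObjective [NeZero N] (hp : ∀ x, p x = 0 → x = 0)
    (hxi : ∀ i, xi i ∈ polyhedron C d) (hε : 0 ≤ ε) (Q : Matrix (Fin n) (Fin m) ℝ)
    (W : Matrix (Fin r) (Fin n) ℝ) (h : Fin r → ℝ) (hne : {y | h ≤ W *ᵥ y}.Nonempty)
    (hY : IsCompact {y | h ≤ W *ᵥ y}) :
    worstCaseExpectation p (polyhedron C d) xi ε (recourseObjective Q W h)
      = objectiveProgram p C d xi ε Q W h := by
  choose f hf using fun ξ : Fin m → ℝ => (hY.image_of_continuousOn (f := (· ⬝ᵥ (Q *ᵥ ξ)))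
    (by fun_prop)).exists_isLeast (hne.image _)
  obtain ⟨L, hL, hLip⟩ := exists_isLipschitzFor_affine hp hY 0 Qᵀ
  simp only [Pi.zero_apply, zero_add, transpose_mulVec_dotProduct] at hLip
  have hcoe : recourseObjective Q W h = fun ξ => (f ξ : EReal) := funext fun ξ =>
    iInf_coe_eq_of_isLeast (hf ξ)
  rw [hcoe, worstCaseExpectation_eq_iInf (.of_isLeast hLip hf) hL measurableSet_polyhedron hxi hε]
  simp only [fun i => isConeMajorant_iff_exists_objective hp hne hY hf (hxi i), Classical.skolem,
    iInf_exists, objectiveProgram]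

theorem worstCaseExpectation_recourseRhs {K : ℕ} [NeZero N] (hp : ∀ x, p x = 0 → x = 0)
    (hxi : ∀ i, xi i ∈ polyhedron C d) (hε : 0 ≤ ε) (q : Fin n → ℝ)
    (W : Matrix (Fin r) (Fin n) ℝ) (H : Matrix (Fin r) (Fin m) ℝ) (h : Fin r → ℝ)
    (v : Fin K → Fin r → ℝ) (hne : (dualFeasible q W).Nonempty)
    (hD : IsCompact (dualFeasible q W))
    (hv : Set.range v = (dualFeasible q W).extremePoints ℝ) :
    worstCaseExpectation p (polyhedron C d) xi ε (recourseRhs q W H h)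
      = rhsProgram p C d xi ε H h v := by
  have haffine : ∀ θ ξ, (H *ᵥ ξ + h) ⬝ᵥ θ = θ ⬝ᵥ h + (Hᵀ *ᵥ θ) ⬝ᵥ ξ := fun θ ξ => by
    rw [transpose_mulVec_dotProduct, ← dotProduct_add, dotProduct_comm, add_comm]
  choose f hfv hfD using fun ξ => exists_isGreatest_image_extremePoints hD hne
    (dotProductEquiv ℝ (Fin r) (H *ᵥ ξ + h)).toContinuousLinearMap
  simp only [LinearMap.coe_toContinuousLinearMap', dotProductEquiv_apply_apply] at hfv hfD
  have hcoe : recourseRhs q W H h = fun ξ => (f ξ : EReal) := funext fun ξ =>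
    iInf_coe_eq_of_isLeast (isLeast_of_isGreatest_dualFeasible (hfD ξ))
  simp only [haffine] at hfv
  obtain ⟨L, hL, hLip⟩ := exists_isLipschitzFor_affine hp hD (· ⬝ᵥ h) Hᵀ
  rw [hcoe, worstCaseExpectation_eq_iInf
    (.of_isGreatest (fun θ hθ => hLip θ (extremePoints_subset hθ)) hfv) hL
    measurableSet_polyhedron hxi hε]
  have hcone : ∀ i t s, IsConeMajorant p (polyhedron C d) f (xi i) t s ↔
      ∀ k, IsConeMajorant p (polyhedron C d) (fun ξ => v k ⬝ᵥ h + (Hᵀ *ᵥ v k) ⬝ᵥ ξ) (xi i) t s := by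
    intro i t s
    rw [isConeMajorant_iff_forall (hD.extremePoints_nonempty hne) fun ξ _ => hfv ξ, ← hv,
      Set.forall_mem_range]
  simp only [hcone, fun i => isConeMajorant_affine_iff hp (hxi i), Classical.skolem, iInf_exists,
    rhsProgram]

end Recourse

end WassersteinDRO

theorem mainTheorem8 {m l N : ℕ} (hN : 1 ≤ N)
    (p : Seminorm ℝ (Fin m → ℝ)) (hp : ∀ ξ, p ξ = 0 → ξ = 0)
    (C : Matrix (Fin l) (Fin m) ℝ) (d : Fin l → ℝ)
    (xi : Fin N → Fin m → ℝ) (hxi : ∀ i, xi i ∈ WassersteinDRO.polyhedron C d)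
    (ε : ℝ) (hε : 0 ≤ ε) :
    (∀ (n r : ℕ) (Q : Matrix (Fin n) (Fin m) ℝ) (W : Matrix (Fin r) (Fin n) ℝ) (h : Fin r → ℝ),
      {y : Fin n → ℝ | h ≤ W *ᵥ y}.Nonempty →
      IsCompact {y : Fin n → ℝ | h ≤ W *ᵥ y} →
      WassersteinDRO.worstCaseExpectation p (WassersteinDRO.polyhedron C d) xi ε
          (WassersteinDRO.recourseObjective Q W h)
        = WassersteinDRO.objectiveProgram p C d xi ε Q W h) ∧
    (∀ (n r K : ℕ) (q : Fin n → ℝ) (W : Matrix (Fin r) (Fin n) ℝ) (H : Matrix (Fin r) (Fin m) ℝ)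
      (h : Fin r → ℝ) (v : Fin K → Fin r → ℝ),
      (WassersteinDRO.dualFeasible q W).Nonempty →
      IsCompact (WassersteinDRO.dualFeasible q W) →
      Set.range v = (WassersteinDRO.dualFeasible q W).extremePoints ℝ →
      WassersteinDRO.worstCaseExpectation p (WassersteinDRO.polyhedron C d) xi ε
          (WassersteinDRO.recourseRhs q W H h)
        = WassersteinDRO.rhsProgram p C d xi ε H h v) := by
  have : NeZero N := ⟨Nat.one_le_iff_ne_zero.1 hN⟩
  exact ⟨fun _ _ Q W h hne hY =>
      WassersteinDRO.worstCaseExpectation_recourseObjective hp hxi hε Q W h hne hY,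
    fun _ _ _ q W H h v hne hD hv =>
      WassersteinDRO.worstCaseExpectation_recourseRhs hp hxi hε q W H h v hne hD hv⟩
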